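/- Let $A$ be a (real or complex, not necessarily unital) Banach algebra, let $A^{op}$ be the Banach algebra with the same underlying Banach space and the reversed product, and let $A\widehat{\otimes}A^{op}$ be their projective tensor product, i.e. the completion of $A\otimes A^{op}$ in the norm $\|u\|=\inf\{\sum_i\|a_i\|\|b_i\| : u=\sum_i a_i\otimes b_i\}$, a Banach algebra under the product determined by $(a\otimes b)(c\otimes d)=(ac)\otimes(b\cdot_{op} d)=(ac)\otimes(db)$. For $a\in A$ define seminorms on $A$ by $\rho_a(b)=\|ab\|$ and $\gamma_a(b)=\|ba\|$. A Banach algebra $B$ is called amenable if for every Banach $B$-bimodule $X$ (a Banach space with a $B$-bimodule structure such that, for some constant $C$, $\|b\cdot x\|\le C\|b\|\|x\|$ and $\|x\cdot b\|\le C\|b\|\|x\|$ for all $b\in B$, $x\in X$), every continuous linear map $D:B\to X^*$ with $D(bc)=b\cdot D(c)+D(b)\cdot c$ for all $b,c\in B$ is inner, i.e. there is $f\in X^*$ with $D(b)=b\cdot f-f\cdot b$ for all $b\in B$. Here $X^*$ carries the dual actions $\langle b\cdot f,x\rangle=\langle f,x\cdot b\rangle$ and $\langle f\cdot b,x\rangle=\langle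 f,b\cdot x\rangle$. Theorem. Suppose that $A\widehat{\otimes}A^{op}$ is amenable, and that each of the two topologies on $A$ induced by the family of seminorms $\{\rho_a : a\in A\}$ and by the family of seminorms $\{\gamma_a : a\in A\}$ is stronger than (that is, finer than or equal to) the weak topology on $A$. Then $A$ is amenable. -/

import Mathlib

open scoped TensorProduct

universe w u v

noncomputable section

/-! ### The projective tensor product of two Banach algebras -/

section ProjectiveTensor

/-- The algebraic tensor product `A ⊗ B`, as a type of its own that carries the projective norm. -/
def AlgTensor (𝕜 A B : Type*) [RCLike 𝕜]
    [NonUnitalNormedRing A] [NormedSpace 𝕜 A] [NonUnitalNormedRing B] [NormedSpace 𝕜 B] :=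
  A ⊗[𝕜] B

variable {𝕜 A B : Type*} [RCLike 𝕜]
  [NonUnitalNormedRing A] [NormedSpace 𝕜 A]
  [NonUnitalNormedRing B] [NormedSpace 𝕜 B]

instance AlgTensor.instAddCommGroup : AddCommGroup (AlgTensor 𝕜 A B) :=
  inferInstanceAs (AddCommGroup (A ⊗[𝕜] B))

instance AlgTensor.instModule : Module 𝕜 (AlgTensor 𝕜 A B) :=
  inferInstanceAs (Module 𝕜 (A ⊗[𝕜] B))

/-- The elementary tensor `a ⊗ b` in the algebraic tensor product. -/
def AlgTensor.tmul (𝕜 : Type*) {A B : Type*} [RCLike 𝕜]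
    [NonUnitalNormedRing A] [NormedSpace 𝕜 A] [NonUnitalNormedRing B] [NormedSpace 𝕜 B]
    (a : A) (b : B) : AlgTensor 𝕜 A B :=
  a ⊗ₜ[𝕜] b

/-- The set of all numbers `∑ ‖aᵢ‖ ‖bᵢ‖`, over all representations `x = ∑ aᵢ ⊗ bᵢ` of `x` as
a finite sum of elementary tensors. -/
def AlgTensor.costs (x : AlgTensor 𝕜 A B) : Set ℝ :=
  {r | ∃ l : List (A × B), (l.map fun p => AlgTensor.tmul 𝕜 p.1 p.2).sum = x ∧
    (l.map fun p => ‖p.1‖ * ‖p.2‖).sum = r}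

theorem AlgTensor.costs_nonempty (x : AlgTensor 𝕜 A B) : x.costs.Nonempty := by
  suffices h : ∃ l : List (A × B), (l.map fun p => AlgTensor.tmul 𝕜 p.1 p.2).sum = x by
    obtain ⟨l, hl⟩ := h
    exact ⟨_, l, hl, rfl⟩
  refine TensorProduct.induction_on (motive := fun x : A ⊗[𝕜] B =>
    ∃ l : List (A × B), (l.map fun p => AlgTensor.tmul 𝕜 p.1 p.2).sum = x) x ?_ ?_ ?_
  · exact ⟨[], rfl⟩
  · intro a b
    exact ⟨[(a, b)], by simp; rfl⟩
  · rintro y z ⟨l, hl⟩ ⟨m, hm⟩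
    refine ⟨l ++ m, ?_⟩
    rw [List.map_append, List.sum_append, hl, hm]
    rfl

theorem AlgTensor.costs_nonneg {x : AlgTensor 𝕜 A B} {r : ℝ} (hr : r ∈ x.costs) : 0 ≤ r := by
  obtain ⟨l, -, rfl⟩ := hr
  refine List.sum_nonneg fun s hs => ?_
  obtain ⟨p, -, rfl⟩ := List.mem_map.1 hs
  positivity

theorem AlgTensor.bddBelow_costs (x : AlgTensor 𝕜 A B) : BddBelow x.costs :=
  ⟨0, fun _ hr => AlgTensor.costs_nonneg hr⟩

/-- The projective norm `‖x‖ = inf { ∑ ‖aᵢ‖ ‖bᵢ‖ : x = ∑ aᵢ ⊗ bᵢ }`. -/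
instance AlgTensor.instNorm : Norm (AlgTensor 𝕜 A B) := ⟨fun x => sInf x.costs⟩

theorem AlgTensor.norm_def (x : AlgTensor 𝕜 A B) : ‖x‖ = sInf x.costs := rfl

theorem AlgTensor.norm_le_of_mem {x : AlgTensor 𝕜 A B} {r : ℝ} (hr : r ∈ x.costs) : ‖x‖ ≤ r :=
  csInf_le x.bddBelow_costs hr

theorem AlgTensor.exists_cost_lt (x : AlgTensor 𝕜 A B) {ε : ℝ} (hε : 0 < ε) :
    ∃ r ∈ x.costs, r < ‖x‖ + ε :=
  exists_lt_of_csInf_lt x.costs_nonempty (lt_add_of_pos_right _ hε)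

theorem AlgTensor.norm_zero' : ‖(0 : AlgTensor 𝕜 A B)‖ = 0 :=
  le_antisymm (AlgTensor.norm_le_of_mem ⟨[], rfl, rfl⟩)
    (le_csInf (AlgTensor.costs_nonempty _) fun _ hr => AlgTensor.costs_nonneg hr)

theorem AlgTensor.norm_add_le' (x y : AlgTensor 𝕜 A B) : ‖x + y‖ ≤ ‖x‖ + ‖y‖ := by
  refine le_of_forall_pos_le_add fun ε hε => ?_
  obtain ⟨r, ⟨l, hl, rfl⟩, hr⟩ := x.exists_cost_lt (half_pos hε)
  obtain ⟨s, ⟨m, hm, rfl⟩, hs⟩ := y.exists_cost_lt (half_pos hε)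
  have h : ‖x + y‖ ≤ (l.map fun p => ‖p.1‖ * ‖p.2‖).sum + (m.map fun p => ‖p.1‖ * ‖p.2‖).sum :=
    AlgTensor.norm_le_of_mem ⟨l ++ m, by simp [hl, hm], by simp⟩
  linarith

theorem AlgTensor.norm_smul_le' (c : 𝕜) (x : AlgTensor 𝕜 A B) : ‖c • x‖ ≤ ‖c‖ * ‖x‖ := by
  have key : ∀ r ∈ x.costs, ‖c • x‖ ≤ ‖c‖ * r := by
    rintro r ⟨l, rfl, rfl⟩
    refine AlgTensor.norm_le_of_mem ⟨l.map fun p => (c • p.1, p.2), ?_, ?_⟩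
    · rw [List.map_map, List.smul_sum, List.map_map]
      rfl
    · rw [List.map_map, ← List.sum_map_mul_left]
      simp [Function.comp_def, norm_smul, mul_assoc]
  refine le_of_forall_pos_le_add fun ε hε => ?_
  have hpos : 0 < ‖c‖ + 1 := by positivity
  obtain ⟨r, hr, hlt⟩ := x.exists_cost_lt (div_pos hε hpos)
  calc ‖c • x‖ ≤ ‖c‖ * r := key r hr
    _ ≤ ‖c‖ * (‖x‖ + ε / (‖c‖ + 1)) := by gcongr
    _ = ‖c‖ * ‖x‖ + ‖c‖ * (ε / (‖c‖ + 1)) := by ring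
    _ ≤ ‖c‖ * ‖x‖ + (‖c‖ + 1) * (ε / (‖c‖ + 1)) := by gcongr; linarith
    _ = ‖c‖ * ‖x‖ + ε := by field_simp

theorem AlgTensor.norm_smul' (c : 𝕜) (x : AlgTensor 𝕜 A B) : ‖c • x‖ = ‖c‖ * ‖x‖ := by
  refine le_antisymm (AlgTensor.norm_smul_le' c x) ?_
  rcases eq_or_ne c 0 with rfl | hc
  · simp [AlgTensor.norm_zero']
  · have h := AlgTensor.norm_smul_le' c⁻¹ (c • x)
    rw [inv_smul_smul₀ hc, norm_inv] at h
    exact (le_inv_mul_iff₀ (norm_pos_iff.2 hc)).1 h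

theorem AlgTensor.seminormedCore : SeminormedSpace.Core 𝕜 (AlgTensor 𝕜 A B) where
  norm_nonneg _ := Real.sInf_nonneg fun _ hr => AlgTensor.costs_nonneg hr
  norm_smul c x := AlgTensor.norm_smul' c x
  norm_triangle := AlgTensor.norm_add_le'

instance AlgTensor.instSeminormedAddCommGroup : SeminormedAddCommGroup (AlgTensor 𝕜 A B) :=
  SeminormedAddCommGroup.ofCore AlgTensor.seminormedCore

instance AlgTensor.instNormedSpace : NormedSpace 𝕜 (AlgTensor 𝕜 A B) where
  norm_smul_le := AlgTensor.norm_smul_le'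

variable [IsScalarTower 𝕜 A A] [SMulCommClass 𝕜 A A]
  [IsScalarTower 𝕜 B B] [SMulCommClass 𝕜 B B]

/-- Multiplication is the bilinear map with `(a ⊗ b) (c ⊗ d) = (a c) ⊗ (b d)`. -/
instance AlgTensor.instMul : Mul (AlgTensor 𝕜 A B) :=
  inferInstanceAs (Mul (A ⊗[𝕜] B))

instance AlgTensor.instNonUnitalRing : NonUnitalRing (AlgTensor 𝕜 A B) where
  __ := AlgTensor.instAddCommGroup
  __ := AlgTensor.instMul
  left_distrib := fun x y z : A ⊗[𝕜] B => mul_add x y z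
  right_distrib := fun x y z : A ⊗[𝕜] B => add_mul x y z
  zero_mul := fun x : A ⊗[𝕜] B => zero_mul x
  mul_zero := fun x : A ⊗[𝕜] B => mul_zero x
  mul_assoc := fun x y z : A ⊗[𝕜] B => mul_assoc x y z

theorem AlgTensor.tmul_mul_tmul (a c : A) (b d : B) :
    AlgTensor.tmul 𝕜 a b * AlgTensor.tmul 𝕜 c d = AlgTensor.tmul 𝕜 (a * c) (b * d) :=
  Algebra.TensorProduct.tmul_mul_tmul a c b d

theorem AlgTensor.norm_mul_le' (x y : AlgTensor 𝕜 A B) : ‖x * y‖ ≤ ‖x‖ * ‖y‖ := by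
  have one : ∀ (a : A) (b : B), ∀ s ∈ y.costs, ‖AlgTensor.tmul 𝕜 a b * y‖ ≤ ‖a‖ * ‖b‖ * s := by
    rintro a b s ⟨m, rfl, rfl⟩
    have h : ‖AlgTensor.tmul 𝕜 a b * (m.map fun p => AlgTensor.tmul 𝕜 p.1 p.2).sum‖ ≤
        ((m.map fun p => (a * p.1, b * p.2)).map fun p => ‖p.1‖ * ‖p.2‖).sum :=
      AlgTensor.norm_le_of_mem ⟨m.map fun p => (a * p.1, b * p.2), by
        rw [List.map_map, ← List.sum_map_mul_left]
        simp [Function.comp_def, AlgTensor.tmul_mul_tmul], rfl⟩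
    refine h.trans ?_
    rw [List.map_map, ← List.sum_map_mul_left]
    refine List.sum_le_sum fun p _ => ?_
    calc ‖a * p.1‖ * ‖b * p.2‖ ≤ (‖a‖ * ‖p.1‖) * (‖b‖ * ‖p.2‖) := by
          gcongr <;> exact norm_mul_le _ _
      _ = ‖a‖ * ‖b‖ * (‖p.1‖ * ‖p.2‖) := by ring
  have two : ∀ r ∈ x.costs, ∀ s ∈ y.costs, ‖x * y‖ ≤ r * s := by
    rintro r ⟨l, rfl, rfl⟩ s hs
    induction l with
    | nil => simp
    | cons p l ih =>
      simp only [List.map_cons, List.sum_cons, add_mul]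
      exact (norm_add_le _ _).trans (add_le_add (one p.1 p.2 s hs) ih)
  have three : ∀ s ∈ y.costs, ‖x * y‖ ≤ ‖x‖ * s := by
    intro s hs
    rcases (AlgTensor.costs_nonneg hs).eq_or_lt with rfl | hpos
    · obtain ⟨r, hr⟩ := x.costs_nonempty
      simpa using two r hr 0 hs
    · rw [← div_le_iff₀ hpos]
      exact le_csInf x.costs_nonempty fun r hr => (div_le_iff₀ hpos).2 (two r hr s hs)
  rcases (norm_nonneg x).eq_or_lt with h0 | hpos
  · obtain ⟨s, hs⟩ := y.costs_nonempty
    simpa [← h0] using three s hs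
  · rw [← div_le_iff₀' hpos]
    exact le_csInf y.costs_nonempty fun s hs => (div_le_iff₀' hpos).2 (three s hs)

instance AlgTensor.instNonUnitalSeminormedRing : NonUnitalSeminormedRing (AlgTensor 𝕜 A B) where
  __ := AlgTensor.instSeminormedAddCommGroup
  __ := AlgTensor.instNonUnitalRing
  norm_mul_le := AlgTensor.norm_mul_le'

instance AlgTensor.instIsScalarTower :
    IsScalarTower 𝕜 (AlgTensor 𝕜 A B) (AlgTensor 𝕜 A B) :=
  inferInstanceAs (IsScalarTower 𝕜 (A ⊗[𝕜] B) (A ⊗[𝕜] B))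

instance AlgTensor.instSMulCommClass :
    SMulCommClass 𝕜 (AlgTensor 𝕜 A B) (AlgTensor 𝕜 A B) :=
  inferInstanceAs (SMulCommClass 𝕜 (A ⊗[𝕜] B) (A ⊗[𝕜] B))

end ProjectiveTensor

section Completion

open UniformSpace

/-- The projective tensor product of `A` and `B`: the completion of the algebraic tensor
product for the projective norm. -/
def ProjTensor (𝕜 A B : Type*) [RCLike 𝕜]
    [NonUnitalNormedRing A] [NormedSpace 𝕜 A] [NonUnitalNormedRing B] [NormedSpace 𝕜 B] :=
  Completion (AlgTensor 𝕜 A B)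

variable {𝕜 A B : Type*} [RCLike 𝕜]
  [NonUnitalNormedRing A] [NormedSpace 𝕜 A]
  [NonUnitalNormedRing B] [NormedSpace 𝕜 B]

instance ProjTensor.instNormedAddCommGroup : NormedAddCommGroup (ProjTensor 𝕜 A B) :=
  inferInstanceAs (NormedAddCommGroup (Completion (AlgTensor 𝕜 A B)))

instance ProjTensor.instNormedSpace : NormedSpace 𝕜 (ProjTensor 𝕜 A B) :=
  inferInstanceAs (NormedSpace 𝕜 (Completion (AlgTensor 𝕜 A B)))

instance ProjTensor.instCompleteSpace : CompleteSpace (ProjTensor 𝕜 A B) :=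
  inferInstanceAs (CompleteSpace (Completion (AlgTensor 𝕜 A B)))

/-- The canonical isometric linear map from the algebraic tensor product. -/
def ProjTensor.ofAlg : AlgTensor 𝕜 A B →ₗᵢ[𝕜] ProjTensor 𝕜 A B :=
  Completion.toComplₗᵢ

theorem ProjTensor.ofAlg_zero :
    (ProjTensor.ofAlg (0 : AlgTensor 𝕜 A B) : ProjTensor 𝕜 A B) = 0 :=
  (ProjTensor.ofAlg : AlgTensor 𝕜 A B →ₗᵢ[𝕜] ProjTensor 𝕜 A B).map_zero

theorem ProjTensor.ofAlg_add (x y : AlgTensor 𝕜 A B) :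
    ProjTensor.ofAlg (x + y) = ProjTensor.ofAlg x + ProjTensor.ofAlg y :=
  (ProjTensor.ofAlg : AlgTensor 𝕜 A B →ₗᵢ[𝕜] ProjTensor 𝕜 A B).map_add x y

theorem ProjTensor.ofAlg_smul (c : 𝕜) (x : AlgTensor 𝕜 A B) :
    ProjTensor.ofAlg (c • x) = c • ProjTensor.ofAlg x :=
  (ProjTensor.ofAlg : AlgTensor 𝕜 A B →ₗᵢ[𝕜] ProjTensor 𝕜 A B).map_smul c x

theorem ProjTensor.norm_ofAlg (x : AlgTensor 𝕜 A B) : ‖ProjTensor.ofAlg x‖ = ‖x‖ :=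
  (ProjTensor.ofAlg : AlgTensor 𝕜 A B →ₗᵢ[𝕜] ProjTensor 𝕜 A B).norm_map x

theorem ProjTensor.isDenseInducing_ofAlg :
    IsDenseInducing (ProjTensor.ofAlg : AlgTensor 𝕜 A B → ProjTensor 𝕜 A B) :=
  Completion.isDenseInducing_coe

/-- A closed property of elements of the completion holds if it holds on algebraic tensors. -/
theorem ProjTensor.induction {p : ProjTensor 𝕜 A B → Prop} (x : ProjTensor 𝕜 A B)
    (hp : IsClosed {x | p x}) (h : ∀ x : AlgTensor 𝕜 A B, p (ProjTensor.ofAlg x)) : p x :=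
  Completion.induction_on x hp h

variable [IsScalarTower 𝕜 A A] [SMulCommClass 𝕜 A A]
  [IsScalarTower 𝕜 B B] [SMulCommClass 𝕜 B B]

/-- Multiplication on the completion is the continuous extension of the multiplication of the
algebraic tensor product. -/
instance ProjTensor.instMul : Mul (ProjTensor 𝕜 A B) where
  mul x y := (ProjTensor.isDenseInducing_ofAlg.prodMap ProjTensor.isDenseInducing_ofAlg).extend
    (fun p : AlgTensor 𝕜 A B × AlgTensor 𝕜 A B => ProjTensor.ofAlg (p.1 * p.2)) (x, y)

theorem ProjTensor.ofAlg_mul (x y : AlgTensor 𝕜 A B) :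
    ProjTensor.ofAlg (x * y) = ProjTensor.ofAlg x * ProjTensor.ofAlg y :=
  ((ProjTensor.isDenseInducing_ofAlg.prodMap ProjTensor.isDenseInducing_ofAlg).extend_eq
    (f := fun p : AlgTensor 𝕜 A B × AlgTensor 𝕜 A B => ProjTensor.ofAlg (p.1 * p.2))
    (ProjTensor.ofAlg.continuous.comp continuous_mul) (x, y)).symm

instance ProjTensor.instContinuousMul : ContinuousMul (ProjTensor 𝕜 A B) where
  continuous_mul := by
    let j : AlgTensor 𝕜 A B →+ ProjTensor 𝕜 A B :=
      (ProjTensor.ofAlg : AlgTensor 𝕜 A B →ₗᵢ[𝕜] ProjTensor 𝕜 A B).toLinearMap.toAddMonoidHom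
    let m := (AddMonoidHom.mul : AlgTensor 𝕜 A B →+ AlgTensor 𝕜 A B →+ AlgTensor 𝕜 A B).compr₂ j
    have hm : Continuous fun p : AlgTensor 𝕜 A B × AlgTensor 𝕜 A B => m p.1 p.2 :=
      ProjTensor.ofAlg.continuous.comp continuous_mul
    have di : IsDenseInducing j := ProjTensor.isDenseInducing_ofAlg
    exact di.extend_Z_bilin di hm

theorem ProjTensor.zero_mul' (x : ProjTensor 𝕜 A B) : 0 * x = 0 := by
  induction x using ProjTensor.induction with
  | hp =>
    exact isClosed_eq (continuous_const.mul continuous_id) continuous_const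
  | h x => rw [← ProjTensor.ofAlg_zero, ← ProjTensor.ofAlg_mul, zero_mul]

theorem ProjTensor.mul_zero' (x : ProjTensor 𝕜 A B) : x * 0 = 0 := by
  induction x using ProjTensor.induction with
  | hp =>
    exact isClosed_eq (continuous_id.mul continuous_const) continuous_const
  | h x => rw [← ProjTensor.ofAlg_zero, ← ProjTensor.ofAlg_mul, mul_zero]

theorem ProjTensor.mul_assoc' (x y z : ProjTensor 𝕜 A B) : x * y * z = x * (y * z) := by
  induction x using ProjTensor.induction with
  | hp =>
    exact isClosed_eq ((continuous_id.mul continuous_const).mul continuous_const)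
      (continuous_id.mul continuous_const)
  | h x =>
  induction y using ProjTensor.induction with
  | hp =>
    exact isClosed_eq ((continuous_const.mul continuous_id).mul continuous_const)
      (continuous_const.mul (continuous_id.mul continuous_const))
  | h y =>
  induction z using ProjTensor.induction with
  | hp =>
    exact isClosed_eq (continuous_const.mul continuous_id)
      (continuous_const.mul (continuous_const.mul continuous_id))
  | h z => simp only [← ProjTensor.ofAlg_mul, mul_assoc]

theorem ProjTensor.mul_add' (x y z : ProjTensor 𝕜 A B) : x * (y + z) = x * y + x * z := by
  induction x using ProjTensor.induction with
  | hp =>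
    exact isClosed_eq (continuous_id.mul continuous_const)
      ((continuous_id.mul continuous_const).add (continuous_id.mul continuous_const))
  | h x =>
  induction y using ProjTensor.induction with
  | hp =>
    exact isClosed_eq (continuous_const.mul (continuous_id.add continuous_const))
      ((continuous_const.mul continuous_id).add continuous_const)
  | h y =>
  induction z using ProjTensor.induction with
  | hp =>
    exact isClosed_eq (continuous_const.mul (continuous_const.add continuous_id))
      (continuous_const.add (continuous_const.mul continuous_id))
  | h z => simp only [← ProjTensor.ofAlg_mul, ← ProjTensor.ofAlg_add, mul_add]

theorem ProjTensor.add_mul' (x y z : ProjTensor 𝕜 A B) : (x + y) * z = x * z + y * z := by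
  induction x using ProjTensor.induction with
  | hp =>
    exact isClosed_eq ((continuous_id.add continuous_const).mul continuous_const)
      ((continuous_id.mul continuous_const).add continuous_const)
  | h x =>
  induction y using ProjTensor.induction with
  | hp =>
    exact isClosed_eq ((continuous_const.add continuous_id).mul continuous_const)
      (continuous_const.add (continuous_id.mul continuous_const))
  | h y =>
  induction z using ProjTensor.induction with
  | hp =>
    exact isClosed_eq (continuous_const.mul continuous_id)
      ((continuous_const.mul continuous_id).add (continuous_const.mul continuous_id))
  | h z => simp only [← ProjTensor.ofAlg_mul, ← ProjTensor.ofAlg_add, add_mul]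

theorem ProjTensor.norm_mul_le' (x y : ProjTensor 𝕜 A B) : ‖x * y‖ ≤ ‖x‖ * ‖y‖ := by
  induction x using ProjTensor.induction with
  | hp =>
    exact isClosed_le (continuous_id.mul continuous_const).norm
      (continuous_norm.mul continuous_const)
  | h x =>
  induction y using ProjTensor.induction with
  | hp =>
    exact isClosed_le (continuous_const.mul continuous_id).norm
      (continuous_const.mul continuous_norm)
  | h y => simpa only [← ProjTensor.ofAlg_mul, ProjTensor.norm_ofAlg] using norm_mul_le x y

theorem ProjTensor.smul_mul' (c : 𝕜) (x y : ProjTensor 𝕜 A B) : c • x * y = c • (x * y) := by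
  induction x using ProjTensor.induction with
  | hp =>
    exact isClosed_eq ((continuous_const_smul c).mul continuous_const)
      ((continuous_id.mul continuous_const).const_smul c)
  | h x =>
  induction y using ProjTensor.induction with
  | hp =>
    exact isClosed_eq (continuous_const.mul continuous_id)
      ((continuous_const.mul continuous_id).const_smul c)
  | h y => simp only [← ProjTensor.ofAlg_mul, ← ProjTensor.ofAlg_smul, smul_mul_assoc]

theorem ProjTensor.mul_smul' (c : 𝕜) (x y : ProjTensor 𝕜 A B) : x * c • y = c • (x * y) := by
  induction x using ProjTensor.induction with
  | hp =>
    exact isClosed_eq (continuous_id.mul continuous_const)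
      ((continuous_id.mul continuous_const).const_smul c)
  | h x =>
  induction y using ProjTensor.induction with
  | hp =>
    exact isClosed_eq (continuous_const.mul (continuous_const_smul c))
      ((continuous_const.mul continuous_id).const_smul c)
  | h y => simp only [← ProjTensor.ofAlg_mul, ← ProjTensor.ofAlg_smul, mul_smul_comm]

instance ProjTensor.instNonUnitalNormedRing : NonUnitalNormedRing (ProjTensor 𝕜 A B) where
  __ := ProjTensor.instNormedAddCommGroup
  __ := ProjTensor.instMul
  zero_mul := ProjTensor.zero_mul'
  mul_zero := ProjTensor.mul_zero'
  mul_assoc := ProjTensor.mul_assoc'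
  left_distrib := ProjTensor.mul_add'
  right_distrib := ProjTensor.add_mul'
  norm_mul_le := ProjTensor.norm_mul_le'

instance ProjTensor.instIsScalarTower :
    IsScalarTower 𝕜 (ProjTensor 𝕜 A B) (ProjTensor 𝕜 A B) :=
  ⟨ProjTensor.smul_mul'⟩

instance ProjTensor.instSMulCommClass :
    SMulCommClass 𝕜 (ProjTensor 𝕜 A B) (ProjTensor 𝕜 A B) :=
  ⟨fun c x y => (ProjTensor.mul_smul' c x y).symm⟩

end Completion

/-! ### Amenability -/

section Amenability

/-- A Banach `A`-bimodule structure on the Banach space `X`: two bilinear actions, `left a x` for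
`a · x` and `right a x` for `x · a`, that make `X` an `A`-bimodule. The bounds
`‖a · x‖ ≤ C ‖a‖ ‖x‖` and `‖x · a‖ ≤ C ‖a‖ ‖x‖` are expressed by the actions being continuous
linear maps from `A` to the bounded operators on `X`. -/
structure BanachBimodule (𝕜 A X : Type*) [RCLike 𝕜] [NonUnitalNormedRing A] [NormedSpace 𝕜 A]
    [NormedAddCommGroup X] [NormedSpace 𝕜 X] where
  left : A →L[𝕜] X →L[𝕜] X
  right : A →L[𝕜] X →L[𝕜] X
  left_mul : ∀ a b x, left (a * b) x = left a (left b x)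
  right_mul : ∀ a b x, right (a * b) x = right b (right a x)
  left_right : ∀ a b x, left a (right b x) = right b (left a x)

variable {𝕜 A X : Type*} [RCLike 𝕜] [NonUnitalNormedRing A] [NormedSpace 𝕜 A]
  [NormedAddCommGroup X] [NormedSpace 𝕜 X]

/-- The dual bimodule: `⟨a · f, x⟩ = ⟨f, x · a⟩` and `⟨f · a, x⟩ = ⟨f, a · x⟩`. -/
def BanachBimodule.dual (M : BanachBimodule 𝕜 A X) : BanachBimodule 𝕜 A (StrongDual 𝕜 X) where
  left := (ContinuousLinearMap.compL 𝕜 X X 𝕜).flip ∘L M.right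
  right := (ContinuousLinearMap.compL 𝕜 X X 𝕜).flip ∘L M.left
  left_mul a b f := by
    ext x
    simp [M.right_mul]
  right_mul a b f := by
    ext x
    simp [M.left_mul]
  left_right a b f := by
    ext x
    simp [M.left_right]

@[simp]
theorem BanachBimodule.dual_left_apply (M : BanachBimodule 𝕜 A X) (a : A)
    (f : StrongDual 𝕜 X) (x : X) : M.dual.left a f x = f (M.right a x) := rfl

@[simp]
theorem BanachBimodule.dual_right_apply (M : BanachBimodule 𝕜 A X) (a : A)
    (f : StrongDual 𝕜 X) (x : X) : M.dual.right a f x = f (M.left a x) := rfl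

/-- `D` is a derivation: `D (a b) = a · D b + D a · b`. -/
def BanachBimodule.IsDerivation (M : BanachBimodule 𝕜 A X) (D : A →L[𝕜] X) : Prop :=
  ∀ a b, D (a * b) = M.left a (D b) + M.right b (D a)

/-- `D` is inner: there is `x` with `D a = a · x - x · a` for all `a`. -/
def BanachBimodule.IsInner (M : BanachBimodule 𝕜 A X) (D : A →L[𝕜] X) : Prop :=
  ∃ x, ∀ a, D a = M.left a x - M.right a x

/-- The Banach algebra `A` is amenable: for every Banach `A`-bimodule `X` (with underlying type
in the universe `w`), every continuous derivation from `A` to the dual bimodule of `X` is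
inner. -/
def IsAmenable (𝕜 : Type v) (A : Type u) [RCLike 𝕜] [NonUnitalNormedRing A]
    [NormedSpace 𝕜 A] : Prop :=
  ∀ (X : Type w) [NormedAddCommGroup X] [NormedSpace 𝕜 X] [CompleteSpace X]
    (M : BanachBimodule 𝕜 A X) (D : A →L[𝕜] StrongDual 𝕜 X),
    M.dual.IsDerivation D → M.dual.IsInner D

end Amenability

/-! ### The topologies on `A` -/

section Topologies

variable (𝕜 A : Type*) [RCLike 𝕜] [NonUnitalNormedRing A] [NormedSpace 𝕜 A]

/-- The seminorms `ρ a : b ↦ ‖a b‖`, for `a` in `A`. -/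
def rhoSeminorms [SMulCommClass 𝕜 A A] : SeminormFamily 𝕜 A A :=
  fun a => (normSeminorm 𝕜 A).comp (LinearMap.mulLeft 𝕜 a)

/-- The seminorms `γ a : b ↦ ‖b a‖`, for `a` in `A`. -/
def gammaSeminorms [IsScalarTower 𝕜 A A] : SeminormFamily 𝕜 A A :=
  fun a => (normSeminorm 𝕜 A).comp (LinearMap.mulRight 𝕜 a)

/-- The locally convex topology on `A` induced by the family of seminorms `ρ a`. -/
abbrev rhoTopology [SMulCommClass 𝕜 A A] : TopologicalSpace A :=
  (rhoSeminorms 𝕜 A).moduleFilterBasis.topology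

/-- The locally convex topology on `A` induced by the family of seminorms `γ a`. -/
abbrev gammaTopology [IsScalarTower 𝕜 A A] : TopologicalSpace A :=
  (gammaSeminorms 𝕜 A).moduleFilterBasis.topology

/-- The weak topology of the Banach space `A`, as a topology on `A` itself. -/
abbrev weakTopology : TopologicalSpace A :=
  TopologicalSpace.induced (toWeakSpace 𝕜 A) inferInstance

end Topologies

end

/-! Amenability of a Banach algebra `R` is equivalent to the existence of a virtual diagonal: an `M`
in the bidual of `R ⊗̂ R`, viewed as a functional on bounded bilinear forms, with `c · M = M · c`
and `c · π(M) = c`, where `π` is multiplication. In this form amenability passes from a tensor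
product to a factor, by freezing the other variable.

Let `M` be a virtual diagonal of `A ⊗̂ B`, with `B` the opposite algebra. Tensor a form `F` on `A`
with the fixed form `κ (b, b') = ψ (p b b' q)` on `B`, where `ψ (p q) = 1`, and put `N F = M (F ⊗
κ)`. Commuting `M` with `c ⊗ d` gives the commutation law for `N`, except that `d` lands next to `p`
on one side and next to `q` on the other. A mixed identity of `B`, itself a slice of the one given
by `π(M)`, lets `d` tend to an identity and removes the discrepancy
(`IsVirtualDiagonal.of_projTensor`). Suitable `p`, `q` exist because an algebra with a mixed
identity and nonzero factors cannot have zero product in a factor.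

A virtual diagonal refers to no module, so `IsVirtualDiagonal.isAmenable` reaches modules in any
universe, although the hypothesis tests only modules in one. -/

noncomputable section

set_option maxSynthPendingDepth 3

/-! ### Slicing a bilinear form by a bidual element -/

section ApplyToRight

open ContinuousLinearMap

variable {𝕜 R : Type*} [RCLike 𝕜] [NonUnitalNormedRing R] [NormedSpace 𝕜 R]

/-- The functional `a ↦ Φ (F (a, ·))`. -/
def applyToRight (Φ : StrongDual 𝕜 (StrongDual 𝕜 R)) :
    (R →L[𝕜] R →L[𝕜] 𝕜) →L[𝕜] StrongDual 𝕜 R :=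
  compL 𝕜 R (StrongDual 𝕜 R) 𝕜 Φ

@[simp]
theorem applyToRight_apply (Φ : StrongDual 𝕜 (StrongDual 𝕜 R)) (F : R →L[𝕜] R →L[𝕜] 𝕜) (a : R) :
    applyToRight Φ F a = Φ (F a) := rfl

end ApplyToRight

/-! ### Amenability and virtual diagonals -/

section VirtualDiagonal

open ContinuousLinearMap

variable {𝕜 : Type v} {R : Type u} [RCLike 𝕜] [NonUnitalNormedRing R] [NormedSpace 𝕜 R]
  [IsScalarTower 𝕜 R R] [SMulCommClass 𝕜 R R]

variable (𝕜 R) in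
/-- The form `F (a, b c)`, as a bounded bilinear function of `c` and `F`. -/
def mulRightForm :
    R →L[𝕜] (R →L[𝕜] R →L[𝕜] 𝕜) →L[𝕜] R →L[𝕜] R →L[𝕜] 𝕜 :=
  compL 𝕜 R (StrongDual 𝕜 R) (StrongDual 𝕜 R) ∘L (compL 𝕜 R R 𝕜).flip ∘L
    (ContinuousLinearMap.mul 𝕜 R).flip

@[simp]
theorem mulRightForm_apply (c : R) (F : R →L[𝕜] R →L[𝕜] 𝕜) (a b : R) :
    mulRightForm 𝕜 R c F a b = F a (b * c) := rfl

variable (𝕜 R) in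
/-- The form `F (c a, b)`, as a bounded bilinear function of `c` and `F`. -/
def mulLeftForm :
    R →L[𝕜] (R →L[𝕜] R →L[𝕜] 𝕜) →L[𝕜] R →L[𝕜] R →L[𝕜] 𝕜 :=
  (compL 𝕜 R R (StrongDual 𝕜 R)).flip ∘L ContinuousLinearMap.mul 𝕜 R

@[simp]
theorem mulLeftForm_apply (c : R) (F : R →L[𝕜] R →L[𝕜] 𝕜) (a b : R) :
    mulLeftForm 𝕜 R c F a b = F (c * a) b := rfl

variable (𝕜 R) in
/-- The functional `f (c a)` of `a`, as a bounded bilinear function of `c` and `f`. -/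
def mulLeftDual :
    R →L[𝕜] StrongDual 𝕜 R →L[𝕜] StrongDual 𝕜 R :=
  (compL 𝕜 R R 𝕜).flip ∘L ContinuousLinearMap.mul 𝕜 R

@[simp]
theorem mulLeftDual_apply (c : R) (f : StrongDual 𝕜 R) (a : R) :
    mulLeftDual 𝕜 R c f a = f (c * a) := rfl

variable (𝕜 R) in
/-- The functional `f (a c)` of `a`, as a bounded bilinear function of `c` and `f`. -/
def mulRightDual :
    R →L[𝕜] StrongDual 𝕜 R →L[𝕜] StrongDual 𝕜 R :=
  (compL 𝕜 R R 𝕜).flip ∘L (ContinuousLinearMap.mul 𝕜 R).flip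

@[simp]
theorem mulRightDual_apply (c : R) (f : StrongDual 𝕜 R) (a : R) :
    mulRightDual 𝕜 R c f a = f (a * c) := rfl

variable (𝕜 R) in
/-- The form `f (a b)` attached to a functional `f`. -/
def dualToForm :
    StrongDual 𝕜 R →L[𝕜] R →L[𝕜] R →L[𝕜] 𝕜 :=
  (compL 𝕜 R (R →L[𝕜] R) (StrongDual 𝕜 R)).flip (ContinuousLinearMap.mul 𝕜 R) ∘L compL 𝕜 R R 𝕜

@[simp]
theorem dualToForm_apply (f : StrongDual 𝕜 R) (a b : R) :
    dualToForm 𝕜 R f a b = f (a * b) := rfl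

/-- `Φ` in the bidual of `R` is a two-sided mixed identity: `c · Φ = c = Φ · c`. -/
structure IsMixedIdentity (Φ : StrongDual 𝕜 (StrongDual 𝕜 R)) : Prop where
  left : ∀ (f : StrongDual 𝕜 R) (c : R), Φ (mulLeftDual 𝕜 R c f) = f c
  right : ∀ (f : StrongDual 𝕜 R) (c : R), Φ (mulRightDual 𝕜 R c f) = f c

/-- A virtual diagonal for `R`, as a functional on the space `(R ⊗̂ R)*` of bounded bilinear
forms. -/
structure IsVirtualDiagonal (M : StrongDual 𝕜 (R →L[𝕜] R →L[𝕜] 𝕜)) : Prop where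
  comm : ∀ (F : R →L[𝕜] R →L[𝕜] 𝕜) (c : R), M (mulLeftForm 𝕜 R c F) = M (mulRightForm 𝕜 R c F)
  unit : ∀ (f : StrongDual 𝕜 R) (c : R), M (dualToForm 𝕜 R (mulLeftDual 𝕜 R c f)) = f c

theorem IsVirtualDiagonal.isMixedIdentity {M : StrongDual 𝕜 (R →L[𝕜] R →L[𝕜] 𝕜)}
    (hM : IsVirtualDiagonal M) : IsMixedIdentity (M ∘L dualToForm 𝕜 R) where
  left f c := hM.unit f c
  right f c := by
    rw [← hM.unit f c]
    have h := hM.comm (dualToForm 𝕜 R f) c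
    have h₁ : mulLeftForm 𝕜 R c (dualToForm 𝕜 R f) = dualToForm 𝕜 R (mulLeftDual 𝕜 R c f) := by
      ext a b; simp [mul_assoc]
    have h₂ : mulRightForm 𝕜 R c (dualToForm 𝕜 R f) = dualToForm 𝕜 R (mulRightDual 𝕜 R c f) := by
      ext a b; simp [mul_assoc]
    rw [h₁, h₂] at h
    exact h.symm

variable (𝕜 R) in
/-- The dual of `R` as a bimodule with trivial left action. -/
def rightDualBimodule : BanachBimodule 𝕜 R (StrongDual 𝕜 R) where
  left := 0
  right := mulLeftDual 𝕜 R
  left_mul _ _ _ := by simp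
  right_mul _ _ _ := by ext; simp [mul_assoc]
  left_right _ _ _ := by simp

variable (𝕜 R) in
/-- The dual of `R` as a bimodule with trivial right action. -/
def leftDualBimodule : BanachBimodule 𝕜 R (StrongDual 𝕜 R) where
  left := mulRightDual 𝕜 R
  right := 0
  left_mul _ _ _ := by ext; simp [mul_assoc]
  right_mul _ _ _ := by simp
  left_right _ _ _ := by simp

/-- When one action is trivial, the embedding of `R` in its bidual is a derivation, and its being
inner produces a one-sided identity. The two one-sided identities are then combined. -/
theorem IsAmenable.exists_isMixedIdentity
    (hR : IsAmenable.{max u v} 𝕜 R) : ∃ Φ : StrongDual 𝕜 (StrongDual 𝕜 R), IsMixedIdentity Φ := by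
  obtain ⟨Φ, hΦ⟩ := hR (StrongDual 𝕜 R) (rightDualBimodule 𝕜 R)
    (NormedSpace.inclusionInDoubleDual 𝕜 R) fun a b => by
      ext f; simp [rightDualBimodule]
  obtain ⟨Ψ, hΨ⟩ := hR (StrongDual 𝕜 R) (leftDualBimodule 𝕜 R)
    (NormedSpace.inclusionInDoubleDual 𝕜 R) fun a b => by
      ext f; simp [leftDualBimodule]
  replace hΦ (f : StrongDual 𝕜 R) (c : R) : Φ (mulLeftDual 𝕜 R c f) = f c := by
    have := DFunLike.congr_fun (hΦ c) f
    simpa [rightDualBimodule] using this.symm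
  replace hΨ (f : StrongDual 𝕜 R) (c : R) : Ψ (mulRightDual 𝕜 R c f) = - f c := by
    have := DFunLike.congr_fun (hΨ c) f
    simp [leftDualBimodule] at this
    simp [this]
  -- Here `-Ψ` is the identity on the other side. With a formal unit, this element `E` satisfies `1
  -- - E = (1 - Φ)(1 + Ψ)`, which `c` kills from the left through `1 - Φ` and from the right through
  -- `1 + Ψ`.
  refine ⟨Φ - Ψ + Φ ∘L applyToRight Ψ ∘L dualToForm 𝕜 R, fun f c => ?_, fun f c => ?_⟩
  · have h : applyToRight Ψ (dualToForm 𝕜 R (mulLeftDual 𝕜 R c f)) =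
        mulLeftDual 𝕜 R c (applyToRight Ψ (dualToForm 𝕜 R f)) := by
      ext a
      simp only [applyToRight_apply, mulLeftDual_apply]
      congr 1
      ext b; simp [mul_assoc]
    have h' : dualToForm 𝕜 R f c = mulLeftDual 𝕜 R c f := by ext; simp
    simp [h, hΦ, h']
  · have h : applyToRight Ψ (dualToForm 𝕜 R (mulRightDual 𝕜 R c f)) =
        - mulRightDual 𝕜 R c f := by
      ext a
      have : dualToForm 𝕜 R (mulRightDual 𝕜 R c f) a =
          mulRightDual 𝕜 R c (dualToForm 𝕜 R f a) := by ext b; simp [mul_assoc]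
      simp [this, hΨ]
    simp [h, hΨ]

variable (𝕜 R) in
/-- The bounded bilinear forms on `R`, with the actions `(F · c) (a, b) = F (c a, b)` and
`(c · F) (a, b) = F (a, b c) - F (a b, c)`. -/
def formBimodule :
    BanachBimodule 𝕜 R (R →L[𝕜] R →L[𝕜] 𝕜) where
  left := mulRightForm 𝕜 R - compL 𝕜 _ _ _ (dualToForm 𝕜 R) ∘L
    (flipₗᵢ 𝕜 R R 𝕜 : (R →L[𝕜] R →L[𝕜] 𝕜) →L[𝕜] R →L[𝕜] R →L[𝕜] 𝕜).flip
  right := mulLeftForm 𝕜 R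
  left_mul _ _ _ := by ext; simp [mul_assoc]
  right_mul _ _ _ := by ext; simp [mul_assoc]
  left_right _ _ _ := by ext; simp [mul_assoc]

theorem formBimodule_left_apply (c : R) (F : R →L[𝕜] R →L[𝕜] 𝕜) :
    (formBimodule 𝕜 R).left c F = mulRightForm 𝕜 R c F - dualToForm 𝕜 R (F.flip c) := rfl

theorem formBimodule_right_apply (c : R) (F : R →L[𝕜] R →L[𝕜] 𝕜) :
    (formBimodule 𝕜 R).right c F = mulLeftForm 𝕜 R c F := rfl

/-- The map `a ⊗ b ↦ a ⊗ b - ab ⊗ 1` identifies `R ⊗̂ R` with the kernel of multiplication on `R ⊗̂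
R#`, where `R#` is the unitization; this explains the twisted action in `formBimodule`. The
derivation `D r = Φ ⊗ r` corresponds to `Φ ⊗ r - r ⊗ 1`, the commutator with `Φ ⊗ 1`. If `ξ`
implements it, then `Φ ⊗ 1 + ξ - π(ξ) ⊗ 1` commutes with `R`. -/
theorem IsAmenable.exists_isVirtualDiagonal
    (hR : IsAmenable.{max u v} 𝕜 R) :
    ∃ M : StrongDual 𝕜 (R →L[𝕜] R →L[𝕜] 𝕜), IsVirtualDiagonal M := by
  obtain ⟨Φ, hΦ⟩ := hR.exists_isMixedIdentity
  let D : R →L[𝕜] StrongDual 𝕜 (R →L[𝕜] R →L[𝕜] 𝕜) :=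
    compL 𝕜 _ _ _ Φ ∘L
      (flipₗᵢ 𝕜 R R 𝕜 : (R →L[𝕜] R →L[𝕜] 𝕜) →L[𝕜] R →L[𝕜] R →L[𝕜] 𝕜).flip
  have hD (r : R) (F : R →L[𝕜] R →L[𝕜] 𝕜) : D r F = Φ (F.flip r) := rfl
  obtain ⟨ξ, hξ⟩ := hR (R →L[𝕜] R →L[𝕜] 𝕜) (formBimodule 𝕜 R) D fun r s => by
    ext F
    have h₁ : (mulLeftForm 𝕜 R r F).flip s = mulLeftDual 𝕜 R r (F.flip s) := by ext; simp
    have h₂ : (mulRightForm 𝕜 R s F).flip r = F.flip (r * s) := by ext; simp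
    have h₃ : (dualToForm 𝕜 R (F.flip s)).flip r = mulRightDual 𝕜 R r (F.flip s) := by
      ext; simp
    have h₄ : (mulRightForm 𝕜 R s F - dualToForm 𝕜 R (F.flip s)).flip r =
      F.flip (r * s) - mulRightDual 𝕜 R r (F.flip s) := by rw [← h₂, ← h₃]; rfl
    simp only [add_apply, BanachBimodule.dual_left_apply, BanachBimodule.dual_right_apply,
      formBimodule_left_apply, formBimodule_right_apply, hD, h₁, h₄, map_sub, hΦ.left, hΦ.right]
    simp
  replace hξ (F : R →L[𝕜] R →L[𝕜] 𝕜) (r : R) : Φ (F.flip r) =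
      ξ (mulLeftForm 𝕜 R r F) - ξ (mulRightForm 𝕜 R r F) + ξ (dualToForm 𝕜 R (F.flip r)) := by
    have := DFunLike.congr_fun (hξ r) F
    simp only [hD, sub_apply, BanachBimodule.dual_left_apply, BanachBimodule.dual_right_apply,
      formBimodule_left_apply, formBimodule_right_apply, map_sub] at this
    rw [this]; ring
  have hleft (f : StrongDual 𝕜 R) (r : R) :
      mulLeftForm 𝕜 R r (dualToForm 𝕜 R f) = dualToForm 𝕜 R (mulLeftDual 𝕜 R r f) := by
    ext; simp [mul_assoc]
  -- Applying `π` to `Φ ⊗ r = r ξ - ξ r + π(ξ) ⊗ r` leaves `r = r π(ξ)`.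
  have hξ' (f : StrongDual 𝕜 R) (r : R) : ξ (dualToForm 𝕜 R (mulLeftDual 𝕜 R r f)) = f r := by
    have h := hξ (dualToForm 𝕜 R f) r
    have h₁ : (dualToForm 𝕜 R f).flip r = mulRightDual 𝕜 R r f := by ext; simp
    have h₂ : mulRightForm 𝕜 R r (dualToForm 𝕜 R f) = dualToForm 𝕜 R (mulRightDual 𝕜 R r f) := by
      ext; simp [mul_assoc]
    rw [h₁, hleft, h₂, hΦ.right] at h
    rw [h]; ring
  -- The commuting element of `R ⊗̂ R#` is brought back to `R ⊗̂ R` by replacing `1` with `Φ`: `Φ ⊗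
  -- Φ + ξ - π(ξ) ⊗ Φ`. Both products with `c` equal `c ξ`.
  refine ⟨Φ ∘L applyToRight Φ + ξ - ξ ∘L dualToForm 𝕜 R ∘L applyToRight Φ,
    fun F c => ?_, fun f c => ?_⟩
  · have h₁ : applyToRight Φ (mulLeftForm 𝕜 R c F) = mulLeftDual 𝕜 R c (applyToRight Φ F) := by
      ext; simp; rfl
    have h₂ : applyToRight Φ (mulRightForm 𝕜 R c F) = F.flip c := by
      ext a
      exact hΦ.right (F a) c
    simp only [sub_apply, add_apply, comp_apply, h₁, h₂, hΦ.left, hξ']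
    rw [hξ F c]
    ring
  · have h : applyToRight Φ (dualToForm 𝕜 R (mulLeftDual 𝕜 R c f)) = mulLeftDual 𝕜 R c f := by
      ext a
      have : dualToForm 𝕜 R (mulLeftDual 𝕜 R c f) a = mulLeftDual 𝕜 R (c * a) f := by
        ext; simp [mul_assoc]
      simp [this, hΦ.left]
    simp [h, hΦ.left, hξ']

/-- The usual candidate `φ`, the value at `M` of `a ⊗ b ↦ a · D b`, implements `D` only on the
closed span of `X · R`. For a general module the remainder `D'` vanishes on `X · R`, hence satisfies
`D' (b c) = D' b · c`, and is implemented separately by means of `Φ`. -/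
theorem IsVirtualDiagonal.isAmenable {M : StrongDual 𝕜 (R →L[𝕜] R →L[𝕜] 𝕜)} (hM : IsVirtualDiagonal M) :
    IsAmenable.{w} 𝕜 R := by
  intro X _ _ _ N D hD
  have hΦ := hM.isMixedIdentity
  set Φ := M ∘L dualToForm 𝕜 R with hΦM
  let S : X →L[𝕜] R →L[𝕜] R →L[𝕜] 𝕜 := compL 𝕜 R X (StrongDual 𝕜 R) D.flip ∘L N.right.flip
  have hS (x : X) (a b : R) : S x a b = D b (N.right a x) := rfl
  let φ : StrongDual 𝕜 X := M ∘L S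
  let D' : R →L[𝕜] StrongDual 𝕜 X := D - (N.dual.left.flip φ - N.dual.right.flip φ)
  have hD' (c : R) : D' c = D c - (N.dual.left c φ - N.dual.right c φ) := rfl
  have key (c : R) (x : X) : D' c x = D c x - Φ ((D c) ∘L N.right.flip x) := by
    have h : mulRightForm 𝕜 R c (S x) =
        S (N.left c x) + dualToForm 𝕜 R ((D c) ∘L N.right.flip x) := by
      ext a b
      simp [hS, hD b c, N.right_mul, N.left_right, add_comm]
    have h' : S (N.right c x) = mulLeftForm 𝕜 R c (S x) := by
      ext a b
      simp [hS, N.right_mul]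
    have e : D' c x = D c x - (M (S (N.right c x)) - M (S (N.left c x))) := rfl
    rw [e, h', hM.comm, h, map_add]
    simp [hΦM]
  have hzero (b c : R) (x : X) : D' b (N.right c x) = 0 := by
    have h : D b ∘L N.right.flip (N.right c x) =
        mulLeftDual 𝕜 R c (D b ∘L N.right.flip x) := by
      ext a; simp [N.right_mul]
    rw [key, h, hΦ.left]
    simp
  have hmul (b c : R) (x : X) : D' (b * c) x = D' b (N.left c x) := by
    have e : D' (b * c) x = D' c (N.right b x) + D' b (N.left c x) := by
      simp only [hD', hD b c, sub_apply, add_apply, BanachBimodule.dual_left_apply,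
        BanachBimodule.dual_right_apply, N.left_mul, N.right_mul, N.left_right]
      ring
    rw [e, hzero, zero_add]
  -- `Φ ∘L D'.flip` is the weak-star value `D' (Φ)`. The left action kills it, and `D' (Φ) · c = D'
  -- (Φ c) = D' c`, whence the minus sign.
  refine ⟨φ - Φ ∘L D'.flip, fun c => ?_⟩
  ext x
  have h₁ : D'.flip (N.right c x) = 0 := by
    ext b; exact hzero b c x
  have h₂ : D'.flip (N.left c x) = mulRightDual 𝕜 R c (D'.flip x) := by
    ext b; exact (hmul b c x).symm
  have h₃ : D' c x = D c x - (φ (N.right c x) - φ (N.left c x)) := rfl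
  simp only [sub_apply, BanachBimodule.dual_left_apply, BanachBimodule.dual_right_apply,
    comp_apply, h₁, h₂, hΦ.right, map_zero, flip_apply, h₃]
  ring

end VirtualDiagonal

/-! ### Universal property of the projective tensor product -/

section Lift

open ContinuousLinearMap

variable {𝕜 A B Z : Type*} [RCLike 𝕜]
  [NonUnitalNormedRing A] [NormedSpace 𝕜 A] [NonUnitalNormedRing B] [NormedSpace 𝕜 B]
  [NormedAddCommGroup Z] [NormedSpace 𝕜 Z]

/-- The linear map on the algebraic tensor product attached to a bilinear map. -/
def AlgTensor.liftLinear (H : A →L[𝕜] B →L[𝕜] Z) : AlgTensor 𝕜 A B →ₗ[𝕜] Z :=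
  TensorProduct.lift ((coeLM 𝕜).comp H.toLinearMap)

theorem AlgTensor.liftLinear_tmul (H : A →L[𝕜] B →L[𝕜] Z) (a : A) (b : B) :
    AlgTensor.liftLinear H (AlgTensor.tmul 𝕜 a b) = H a b :=
  TensorProduct.lift.tmul a b

theorem AlgTensor.norm_liftLinear_le (H : A →L[𝕜] B →L[𝕜] Z) (x : AlgTensor 𝕜 A B) :
    ‖AlgTensor.liftLinear H x‖ ≤ ‖H‖ * ‖x‖ := by
  have key : ∀ r ∈ x.costs, ‖AlgTensor.liftLinear H x‖ ≤ ‖H‖ * r := by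
    rintro r ⟨l, rfl, rfl⟩
    induction l with
    | nil => simp
    | cons p l ih =>
      simp only [List.map_cons, List.sum_cons, map_add, mul_add, AlgTensor.liftLinear_tmul]
      refine (norm_add_le _ _).trans (add_le_add ?_ ih)
      rw [← mul_assoc]
      exact H.le_opNorm₂ _ _
  refine le_of_forall_pos_le_add fun ε hε => ?_
  -- Adding `1` keeps the divisor positive when `H = 0`.
  have hpos : 0 < ‖H‖ + 1 := by positivity
  obtain ⟨r, hr, hlt⟩ := x.exists_cost_lt (div_pos hε hpos)
  calc ‖AlgTensor.liftLinear H x‖ ≤ ‖H‖ * r := key r hr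
    _ ≤ ‖H‖ * (‖x‖ + ε / (‖H‖ + 1)) := by gcongr
    _ = ‖H‖ * ‖x‖ + ‖H‖ * (ε / (‖H‖ + 1)) := by ring
    _ ≤ ‖H‖ * ‖x‖ + (‖H‖ + 1) * (ε / (‖H‖ + 1)) := by gcongr; linarith
    _ = ‖H‖ * ‖x‖ + ε := by field_simp

theorem AlgTensor.span_tmul :
    Submodule.span 𝕜 (Set.range fun p : A × B => AlgTensor.tmul 𝕜 p.1 p.2) = ⊤ := by
  refine Eq.trans (congrArg (Submodule.span 𝕜) (Set.ext fun x => ?_))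
    (TensorProduct.span_tmul_eq_top 𝕜 A B)
  simp only [Set.mem_range, Prod.exists]
  rfl

/-- The elementary tensor `a ⊗ b` in the projective tensor product. -/
def ProjTensor.tmul (𝕜 : Type*) {A B : Type*} [RCLike 𝕜]
    [NonUnitalNormedRing A] [NormedSpace 𝕜 A] [NonUnitalNormedRing B] [NormedSpace 𝕜 B]
    (a : A) (b : B) : ProjTensor 𝕜 A B :=
  ProjTensor.ofAlg (AlgTensor.tmul 𝕜 a b)

theorem ProjTensor.denseRange_ofAlg :
    DenseRange (ProjTensor.ofAlg : AlgTensor 𝕜 A B → ProjTensor 𝕜 A B) :=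
  ProjTensor.isDenseInducing_ofAlg.dense

/-- Bounded linear maps on the projective tensor product are determined on elementary tensors. -/
theorem ProjTensor.hom_ext {S T : ProjTensor 𝕜 A B →L[𝕜] Z}
    (h : ∀ a b, S (ProjTensor.tmul 𝕜 a b) = T (ProjTensor.tmul 𝕜 a b)) : S = T := by
  have h' : S.toLinearMap.comp ProjTensor.ofAlg.toLinearMap =
      T.toLinearMap.comp (ProjTensor.ofAlg (𝕜 := 𝕜) (A := A) (B := B)).toLinearMap := by
    refine LinearMap.ext_on_range AlgTensor.span_tmul fun p => ?_
    exact h p.1 p.2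
  refine ContinuousLinearMap.ext fun x => ?_
  refine ProjTensor.induction x (isClosed_eq S.continuous T.continuous) fun x => ?_
  exact LinearMap.congr_fun h' x

theorem ProjTensor.tmul_mul_tmul [IsScalarTower 𝕜 A A] [SMulCommClass 𝕜 A A]
    [IsScalarTower 𝕜 B B] [SMulCommClass 𝕜 B B] (a c : A) (b d : B) :
    ProjTensor.tmul 𝕜 a b * ProjTensor.tmul 𝕜 c d = ProjTensor.tmul 𝕜 (a * c) (b * d) := by
  rw [tmul, tmul, ← ProjTensor.ofAlg_mul, AlgTensor.tmul_mul_tmul]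
  rfl

variable [CompleteSpace Z]

/-- The bounded linear map on the projective tensor product attached to a bounded bilinear map. -/
def ProjTensor.liftMap (H : A →L[𝕜] B →L[𝕜] Z) : ProjTensor 𝕜 A B →L[𝕜] Z :=
  ((AlgTensor.liftLinear H).mkContinuous ‖H‖ (AlgTensor.norm_liftLinear_le H)).extend
    (ProjTensor.ofAlg : AlgTensor 𝕜 A B →ₗᵢ[𝕜] ProjTensor 𝕜 A B).toContinuousLinearMap

theorem ProjTensor.liftMap_ofAlg (H : A →L[𝕜] B →L[𝕜] Z) (x : AlgTensor 𝕜 A B) :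
    ProjTensor.liftMap H (ProjTensor.ofAlg x) = AlgTensor.liftLinear H x := by
  have h := ((AlgTensor.liftLinear H).mkContinuous ‖H‖ (AlgTensor.norm_liftLinear_le H)).extend_eq
    (e := (ProjTensor.ofAlg : AlgTensor 𝕜 A B →ₗᵢ[𝕜] ProjTensor 𝕜 A B).toContinuousLinearMap)
    ProjTensor.denseRange_ofAlg ProjTensor.ofAlg.isometry.isUniformInducing x
  exact h

theorem ProjTensor.liftMap_tmul (H : A →L[𝕜] B →L[𝕜] Z) (a : A) (b : B) :
    ProjTensor.liftMap H (ProjTensor.tmul 𝕜 a b) = H a b := by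
  rw [← AlgTensor.liftLinear_tmul, ← ProjTensor.liftMap_ofAlg]
  rfl

theorem ProjTensor.norm_liftMap_le (H : A →L[𝕜] B →L[𝕜] Z) : ‖ProjTensor.liftMap H‖ ≤ ‖H‖ := by
  refine opNorm_le_bound _ (norm_nonneg H) fun x => ?_
  induction x using ProjTensor.induction with
  | hp =>
    exact isClosed_le (ProjTensor.liftMap H).continuous.norm
      (continuous_const.mul continuous_norm)
  | h x =>
  rw [ProjTensor.liftMap_ofAlg, ProjTensor.norm_ofAlg]
  exact AlgTensor.norm_liftLinear_le H x

variable (𝕜 A B Z) in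
/-- The map `ProjTensor.liftMap`, as a bounded linear map. -/
def ProjTensor.lift : (A →L[𝕜] B →L[𝕜] Z) →L[𝕜] ProjTensor 𝕜 A B →L[𝕜] Z :=
  LinearMap.mkContinuous
    { toFun := ProjTensor.liftMap
      map_add' := fun H K => ProjTensor.hom_ext fun a b => by simp [ProjTensor.liftMap_tmul]
      map_smul' := fun c H => ProjTensor.hom_ext fun a b => by simp [ProjTensor.liftMap_tmul] }
    1 fun H => by simpa using ProjTensor.norm_liftMap_le H

theorem ProjTensor.lift_tmul (H : A →L[𝕜] B →L[𝕜] Z) (a : A) (b : B) :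
    ProjTensor.lift 𝕜 A B Z H (ProjTensor.tmul 𝕜 a b) = H a b :=
  ProjTensor.liftMap_tmul H a b

variable (𝕜 A B) in
/-- The functional `f ⊗ k` on the projective tensor product. -/
def ProjTensor.dualTmul :
    StrongDual 𝕜 A →L[𝕜] StrongDual 𝕜 B →L[𝕜] StrongDual 𝕜 (ProjTensor 𝕜 A B) :=
  compL 𝕜 (StrongDual 𝕜 B) (A →L[𝕜] B →L[𝕜] 𝕜) (StrongDual 𝕜 (ProjTensor 𝕜 A B))
      (ProjTensor.lift 𝕜 A B 𝕜) ∘L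
    (smulRightL 𝕜 A (StrongDual 𝕜 B))

theorem ProjTensor.dualTmul_tmul (f : StrongDual 𝕜 A) (k : StrongDual 𝕜 B) (a : A) (b : B) :
    ProjTensor.dualTmul 𝕜 A B f k (ProjTensor.tmul 𝕜 a b) = f a * k b :=
  ProjTensor.lift_tmul _ a b

variable (𝕜 A B) in
/-- The bilinear form `F ⊗ K` on the projective tensor product, with
`(F ⊗ K) (a ⊗ b, a' ⊗ b') = F (a, a') K (b, b')`. -/
def ProjTensor.formTmul :
    (B →L[𝕜] B →L[𝕜] 𝕜) →L[𝕜] (A →L[𝕜] A →L[𝕜] 𝕜) →L[𝕜]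
      ProjTensor 𝕜 A B →L[𝕜] ProjTensor 𝕜 A B →L[𝕜] 𝕜 :=
  compL 𝕜 (A →L[𝕜] A →L[𝕜] 𝕜) (A →L[𝕜] B →L[𝕜] StrongDual 𝕜 (ProjTensor 𝕜 A B)) _
      (ProjTensor.lift 𝕜 A B _) ∘L
    (compL 𝕜 (A →L[𝕜] A →L[𝕜] 𝕜) (A →L[𝕜] StrongDual 𝕜 B →L[𝕜] StrongDual 𝕜 (ProjTensor 𝕜 A B))
      (A →L[𝕜] B →L[𝕜] StrongDual 𝕜 (ProjTensor 𝕜 A B))).flip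
      (compL 𝕜 A _ _ (ProjTensor.dualTmul 𝕜 A B)) ∘L
    compL 𝕜 A (StrongDual 𝕜 B →L[𝕜] StrongDual 𝕜 (ProjTensor 𝕜 A B))
      (B →L[𝕜] StrongDual 𝕜 (ProjTensor 𝕜 A B)) ∘L
    (compL 𝕜 B (StrongDual 𝕜 B) (StrongDual 𝕜 (ProjTensor 𝕜 A B))).flip

theorem ProjTensor.formTmul_tmul (K : B →L[𝕜] B →L[𝕜] 𝕜) (F : A →L[𝕜] A →L[𝕜] 𝕜)
    (a a' : A) (b b' : B) :
    ProjTensor.formTmul 𝕜 A B K F (ProjTensor.tmul 𝕜 a b) (ProjTensor.tmul 𝕜 a' b') =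
      F a a' * K b b' := by
  have h : ProjTensor.formTmul 𝕜 A B K F (ProjTensor.tmul 𝕜 a b) =
      ProjTensor.dualTmul 𝕜 A B (F a) (K b) := ProjTensor.lift_tmul _ a b
  rw [h, ProjTensor.dualTmul_tmul]

theorem ProjTensor.form_ext {S T : ProjTensor 𝕜 A B →L[𝕜] ProjTensor 𝕜 A B →L[𝕜] 𝕜}
    (h : ∀ a b a' b', S (ProjTensor.tmul 𝕜 a b) (ProjTensor.tmul 𝕜 a' b') =
      T (ProjTensor.tmul 𝕜 a b) (ProjTensor.tmul 𝕜 a' b')) : S = T :=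
  ProjTensor.hom_ext fun a b => ProjTensor.hom_ext fun a' b' => h a b a' b'

end Lift

/-! ### Passing from a tensor product to its factors -/

section Transfer

open ContinuousLinearMap

variable {𝕜 A B : Type*} [RCLike 𝕜]
  [NonUnitalNormedRing A] [NormedSpace 𝕜 A] [NonUnitalNormedRing B] [NormedSpace 𝕜 B]
  [IsScalarTower 𝕜 A A] [SMulCommClass 𝕜 A A] [IsScalarTower 𝕜 B B] [SMulCommClass 𝕜 B B]

/-- If `A` had zero product, so would the tensor product, and the mixed identity would force every
functional to vanish on every `a ⊗ b`. -/
theorem IsMixedIdentity.exists_mul_ne_zero {Φ : StrongDual 𝕜 (StrongDual 𝕜 (ProjTensor 𝕜 A B))}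
    (hΦ : IsMixedIdentity Φ) [Nontrivial A] [Nontrivial B] : ∃ s t : A, s * t ≠ 0 := by
  by_contra! h
  obtain ⟨a, ha⟩ := exists_ne (0 : A)
  obtain ⟨b, hb⟩ := exists_ne (0 : B)
  obtain ⟨f, hf⟩ := SeparatingDual.exists_eq_one (R := 𝕜) ha
  obtain ⟨k, hk⟩ := SeparatingDual.exists_eq_one (R := 𝕜) hb
  have h₁ := hΦ.left (ProjTensor.dualTmul 𝕜 A B f k) (ProjTensor.tmul 𝕜 a b)
  have h₂ : mulLeftDual 𝕜 (ProjTensor 𝕜 A B) (ProjTensor.tmul 𝕜 a b)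
      (ProjTensor.dualTmul 𝕜 A B f k) = 0 := ProjTensor.hom_ext fun a' b' => by
    rw [mulLeftDual_apply, ProjTensor.tmul_mul_tmul, ProjTensor.dualTmul_tmul, h]
    simp
  rw [h₂, ProjTensor.dualTmul_tmul, hf, hk] at h₁
  simp at h₁

/-- A mixed identity of a projective tensor product yields one of the second factor, as soon as
the product of the first factor is not zero. -/
theorem IsMixedIdentity.of_projTensor {Φ : StrongDual 𝕜 (StrongDual 𝕜 (ProjTensor 𝕜 A B))}
    (hΦ : IsMixedIdentity Φ) {s t : A} (hst : s * t ≠ 0) :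
    ∃ Ψ : StrongDual 𝕜 (StrongDual 𝕜 B), IsMixedIdentity Ψ := by
  obtain ⟨θ, hθ⟩ := SeparatingDual.exists_eq_one (R := 𝕜) hst
  -- The functional `a ↦ θ (s a t)` can absorb a left factor `s ⊗ c` or a right factor `t ⊗ c`;
  -- either way the mixed identity returns `θ (s t) f c = f c`.
  refine ⟨Φ ∘L ProjTensor.dualTmul 𝕜 A B (mulLeftDual 𝕜 A s (mulRightDual 𝕜 A t θ)),
    fun f c => ?_, fun f c => ?_⟩
  · have h : ProjTensor.dualTmul 𝕜 A B (mulLeftDual 𝕜 A s (mulRightDual 𝕜 A t θ))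
        (mulLeftDual 𝕜 B c f) = mulLeftDual 𝕜 (ProjTensor 𝕜 A B) (ProjTensor.tmul 𝕜 s c)
          (ProjTensor.dualTmul 𝕜 A B (mulRightDual 𝕜 A t θ) f) := ProjTensor.hom_ext fun a b => by
      rw [mulLeftDual_apply, ProjTensor.tmul_mul_tmul, ProjTensor.dualTmul_tmul,
        ProjTensor.dualTmul_tmul]
      simp
    rw [comp_apply, h, hΦ.left, ProjTensor.dualTmul_tmul, mulRightDual_apply, hθ, one_mul]
  · have h : ProjTensor.dualTmul 𝕜 A B (mulLeftDual 𝕜 A s (mulRightDual 𝕜 A t θ))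
        (mulRightDual 𝕜 B c f) = mulRightDual 𝕜 (ProjTensor 𝕜 A B) (ProjTensor.tmul 𝕜 t c)
          (ProjTensor.dualTmul 𝕜 A B (mulLeftDual 𝕜 A s θ) f) := ProjTensor.hom_ext fun a b => by
      rw [mulRightDual_apply, ProjTensor.tmul_mul_tmul, ProjTensor.dualTmul_tmul,
        ProjTensor.dualTmul_tmul]
      simp [mul_assoc]
    rw [comp_apply, h, hΦ.right, ProjTensor.dualTmul_tmul, mulLeftDual_apply, hθ, one_mul]

/-- A virtual diagonal of a projective tensor product yields one of the first factor, as soon as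
neither factor has zero product. -/
theorem IsVirtualDiagonal.of_projTensor
    {M : StrongDual 𝕜 (ProjTensor 𝕜 A B →L[𝕜] ProjTensor 𝕜 A B →L[𝕜] 𝕜)}
    (hM : IsVirtualDiagonal M) {s t : A} (hst : s * t ≠ 0) {p q : B} (hpq : p * q ≠ 0) :
    ∃ N : StrongDual 𝕜 (A →L[𝕜] A →L[𝕜] 𝕜), IsVirtualDiagonal N := by
  obtain ⟨Φ, hΦ⟩ := hM.isMixedIdentity.of_projTensor hst
  obtain ⟨ψ, hψ⟩ := SeparatingDual.exists_eq_one (R := 𝕜) hpq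
  let κ (y z : B) : B →L[𝕜] B →L[𝕜] 𝕜 :=
    mulLeftForm 𝕜 B y (mulRightForm 𝕜 B z (dualToForm 𝕜 B ψ))
  have hκ (y z b b' : B) : κ y z b b' = ψ (y * b * (b' * z)) := rfl
  have shift (F : A →L[𝕜] A →L[𝕜] 𝕜) (c : A) (y d z : B) :
      M (ProjTensor.formTmul 𝕜 A B (κ (y * d) z) (mulLeftForm 𝕜 A c F)) =
        M (ProjTensor.formTmul 𝕜 A B (κ y (d * z)) (mulRightForm 𝕜 A c F)) := by
    have h := hM.comm (ProjTensor.formTmul 𝕜 A B (κ y z) F) (ProjTensor.tmul 𝕜 c d)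
    convert h using 2
    · refine ProjTensor.form_ext fun a b a' b' => ?_
      rw [mulLeftForm_apply, ProjTensor.tmul_mul_tmul, ProjTensor.formTmul_tmul,
        ProjTensor.formTmul_tmul, hκ, hκ, mulLeftForm_apply]
      simp only [mul_assoc]
    · refine ProjTensor.form_ext fun a b a' b' => ?_
      rw [mulRightForm_apply, ProjTensor.tmul_mul_tmul, ProjTensor.formTmul_tmul,
        ProjTensor.formTmul_tmul, hκ, hκ, mulRightForm_apply]
      simp only [mul_assoc]
  refine ⟨M ∘L ProjTensor.formTmul 𝕜 A B (κ p q), fun F c => ?_, fun f c => ?_⟩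
  · let g : StrongDual 𝕜 B := M ∘L (ProjTensor.formTmul 𝕜 A B).flip (mulLeftForm 𝕜 A c F) ∘L
      (mulLeftForm 𝕜 B).flip (mulRightForm 𝕜 B q (dualToForm 𝕜 B ψ))
    let h : StrongDual 𝕜 B := M ∘L (ProjTensor.formTmul 𝕜 A B).flip (mulRightForm 𝕜 A c F) ∘L
      (mulRightForm 𝕜 B).flip (mulLeftForm 𝕜 B p (dualToForm 𝕜 B ψ))
    -- By `shift`, `g (p d) = h (d q)` for every `d`. Evaluating `Φ` in the variable `d` turns this
    -- into `g p = h q`, which is the required commutation.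
    have hgh : mulLeftDual 𝕜 B p g = mulRightDual 𝕜 B q h := by
      ext d
      exact shift F c p d q
    have hpq' : g p = h q := by rw [← hΦ.left g p, hgh, hΦ.right h q]
    exact hpq'
  -- On elementary tensors the form is `f (c a a') ψ (p b b' q)`. It depends only on the product and
  -- has left factor `c ⊗ p`, so the unit law of `M` gives `f c * ψ (p q)`.
  · have h : ProjTensor.formTmul 𝕜 A B (κ p q) (dualToForm 𝕜 A (mulLeftDual 𝕜 A c f)) =
        dualToForm 𝕜 (ProjTensor 𝕜 A B) (mulLeftDual 𝕜 (ProjTensor 𝕜 A B) (ProjTensor.tmul 𝕜 c p)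
          (ProjTensor.dualTmul 𝕜 A B f (mulRightDual 𝕜 B q ψ))) := by
      refine ProjTensor.form_ext fun a b a' b' => ?_
      rw [dualToForm_apply, mulLeftDual_apply, ProjTensor.tmul_mul_tmul, ProjTensor.tmul_mul_tmul,
        ProjTensor.formTmul_tmul, ProjTensor.dualTmul_tmul, hκ]
      simp [mul_assoc]
    rw [comp_apply, h, hM.unit, ProjTensor.dualTmul_tmul, mulRightDual_apply, hψ, mul_one]

end Transfer

end

/-- In the order on topologies, `s ≤ t` says that `s` is finer (stronger) than `t`. -/
theorem theorem2p6 {𝕜 : Type} [RCLike 𝕜] {A : Type u} [NonUnitalNormedRing A]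
    [NormedSpace 𝕜 A] [IsScalarTower 𝕜 A A] [SMulCommClass 𝕜 A A] [CompleteSpace A]
    (hA : IsAmenable.{u} 𝕜 (ProjTensor 𝕜 A Aᵐᵒᵖ))
    (hρ : rhoTopology 𝕜 A ≤ weakTopology 𝕜 A)
    (hγ : gammaTopology 𝕜 A ≤ weakTopology 𝕜 A) :
    IsAmenable.{w} 𝕜 A := by
  -- The hypotheses on the topologies are not needed: a virtual diagonal of the tensor product
  -- already yields one of each of its factors.
  rcases subsingleton_or_nontrivial A with _ | _
  · intro X _ _ _ N D _
    exact ⟨0, fun a => by simp [Subsingleton.elim a 0]⟩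
  · obtain ⟨M, hM⟩ := hA.exists_isVirtualDiagonal
    obtain ⟨s, t, hst⟩ := hM.isMixedIdentity.exists_mul_ne_zero
    -- In the opposite algebra this product is `op (s * t)`, so the same pair serves both factors.
    have hts : MulOpposite.op t * MulOpposite.op s ≠ 0 := by
      rwa [← MulOpposite.op_mul, Ne, MulOpposite.op_eq_zero_iff]
    obtain ⟨N, hN⟩ := hM.of_projTensor hst hts
    exact hN.isAmenable
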